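/- Let $X$ be a complex Banach space and let $T$ be a bounded linear operator on $X$ that is power-bounded, i.e. $\sup_{n\ge 0}\|T^n\|<\infty$. Write $\mathbb T=\{z\in\mathbb C: |z|=1\}$ and assume that $\sigma(T)\cap\mathbb T$ is (finite or infinitely) countable. Then, for every $x\in X$, the following are equivalent: (i) there exists a strictly increasing sequence $(n_j)$ of natural numbers such that $T^{n_j}x\to 0$ weakly as $j\to\infty$; (ii) $\frac1n\sum_{k=1}^n|\langle x^*,T^kx\rangle|\to 0$ as $n\to\infty$, for every $x^*\in X^*$; (iii) $\|T^nx\|\to 0$ as $n\to\infty$. -/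

import Mathlib

open Filter Topology

/-- A bounded linear operator `T` is power-bounded if `sup_n ‖T ^ n‖ < ∞`. -/
def IsPowerBounded {X : Type*} [NormedAddCommGroup X] [NormedSpace ℂ X] (T : X →L[ℂ] X) : Prop :=
  ∃ M : ℝ, ∀ n : ℕ, ‖T ^ n‖ ≤ M

/-! Conditions (i) and (ii) are used only to show that a functional `φ` with `‖φ (T ^ k x)‖`
constant in `k` vanishes at `x`. Restrict `T` to the closed linear span of the orbit: the peripheral
spectrum stays countable, and by Hahn–Banach a unimodular eigenfunctional of the restriction extends
to such a `φ`, hence is zero. So the Arendt–Batty–Lyubich–Vũ theorem (`tendsto_norm_pow_apply_zero`)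
applies.

For that theorem, complete the space in the seminorm `limsup ‖T ^ n x‖`; `T` becomes an isometry `S`
(`exists_limit_isometry`). If the completion is nonzero, the spectrum of `S` is a nonempty countable
closed subset of the circle, so it has an isolated point `μ`, a simple pole of the resolvent. Its
leading coefficient `P` satisfies `P S = μ P` and yields a nonzero eigenfunctional. -/

/-! ### Isolated singularities and simple poles of the resolvent -/

/-- A function holomorphic on a punctured disc and growing at most like `C / |im w|` grows at most
like `1 / |w|` at the centre. -/
theorem norm_mul_norm_le_of_abs_im_mul_norm_le {E : Type*} [NormedAddCommGroup E] [NormedSpace ℂ E]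
    {F : ℂ → E} {δ C : ℝ}
    (hd : ∀ w : ℂ, w ≠ 0 → ‖w‖ < δ → DifferentiableAt ℂ F w)
    (hC : ∀ w : ℂ, w ≠ 0 → ‖w‖ < δ → |w.im| * ‖F w‖ ≤ C) {w : ℂ} (hw : w ≠ 0)
    (hwδ : 2 * ‖w‖ < δ) : ‖w‖ * ‖F w‖ ≤ 15 * C := by
  set s := ‖w‖ with hs
  have hs0 : 0 < s := norm_pos_iff.2 hw
  have hC0 : 0 ≤ C := (by positivity : 0 ≤ |w.im| * ‖F w‖).trans (hC w hw (by linarith))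
  have hcirc : ∀ (v : ℂ) (r : ℝ), ‖v‖ = r → ‖v ^ 2 - (r : ℂ) ^ 2‖ = 2 * r * |v.im| := by
    intro v r hv
    have h1 : (r : ℂ) ^ 2 = v * (starRingEnd ℂ) v := by
      rw [Complex.mul_conj, Complex.normSq_eq_norm_sq, hv]; push_cast; ring
    have h2 : v ^ 2 - (r : ℂ) ^ 2 = v * (((2 * v.im : ℝ) : ℂ) * Complex.I) := by
      rw [h1, ← Complex.sub_conj]; ring
    rw [h2, norm_mul, norm_mul, Complex.norm_real, hv, Complex.norm_I, Real.norm_eq_abs, abs_mul]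
    norm_num; ring
  have hup : ∀ (v : ℂ) (r a : ℝ), ‖v‖ ≤ a → 0 ≤ r → r ≤ a → ‖v ^ 2 - (r : ℂ) ^ 2‖ ≤ 2 * a ^ 2 := by
    intro v r a hv hr hra
    have h1 : ‖v‖ ^ 2 ≤ a ^ 2 := pow_le_pow_left₀ (norm_nonneg _) hv 2
    have h2 : r ^ 2 ≤ a ^ 2 := pow_le_pow_left₀ hr hra 2
    calc ‖v ^ 2 - (r : ℂ) ^ 2‖ ≤ ‖v ^ 2‖ + ‖(r : ℂ) ^ 2‖ := norm_sub_le _ _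
      _ = ‖v‖ ^ 2 + r ^ 2 := by rw [norm_pow, norm_pow, Complex.norm_real, Real.norm_eq_abs, sq_abs]
      _ ≤ 2 * a ^ 2 := by linarith
  set U : Set ℂ := {z | s / 2 < ‖z‖ ∧ ‖z‖ < 2 * s} with hU
  have hUo : IsOpen U := (isOpen_lt continuous_const continuous_norm).inter
    (isOpen_lt continuous_norm continuous_const)
  have hUc : closure U ⊆ {z | s / 2 ≤ ‖z‖ ∧ ‖z‖ ≤ 2 * s} :=
    closure_minimal (fun z hz => ⟨hz.1.le, hz.2.le⟩)
      ((isClosed_le continuous_const continuous_norm).inter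
        (isClosed_le continuous_norm continuous_const))
  have hUb : Bornology.IsBounded U :=
    (Metric.isBounded_ball (x := (0 : ℂ)) (r := 2 * s)).subset fun z hz => by simpa using hz.2
  -- On `‖v‖ = r` the factor `v ^ 2 - r ^ 2` has modulus `2 * r * |v.im|`, which absorbs the blow-up
  -- of `F` at the real axis. One factor serves each boundary circle of the annulus, and the maximum
  -- principle does the rest.
  set h : ℂ → E := fun v =>
    ((v ^ 2 - ((2 * s : ℝ) : ℂ) ^ 2) * (v ^ 2 - ((s / 2 : ℝ) : ℂ) ^ 2)) • F v with hh
  have hne : ∀ v ∈ closure U, v ≠ 0 ∧ ‖v‖ < δ := fun v hv =>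
    ⟨norm_pos_iff.1 (by linarith [(hUc hv).1]), (hUc hv).2.trans_lt hwδ⟩
  have hdiff : DiffContOnCl ℂ h U := by
    apply DifferentiableOn.diffContOnCl
    intro v hv
    have := hd v (hne v hv).1 (hne v hv).2
    exact DifferentiableAt.differentiableWithinAt (by fun_prop)
  have hfr : ∀ v ∈ frontier U, ‖h v‖ ≤ 32 * s ^ 3 * C := by
    intro v hv
    have hvc := hUc hv.1
    have hvn : ¬ (s / 2 < ‖v‖ ∧ ‖v‖ < 2 * s) := by
      have := hv.2; rwa [hUo.interior_eq] at this
    have hF := hC v (hne v hv.1).1 (hne v hv.1).2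
    simp only [hh, norm_smul, norm_mul]
    rcases hvc.2.lt_or_eq with h2 | h2
    · have h1 : ‖v‖ = s / 2 := le_antisymm (not_lt.1 fun h => hvn ⟨h, h2⟩) hvc.1
      rw [hcirc v _ h1]
      have := hup v (2 * s) (2 * s) hvc.2 (by positivity) le_rfl
      calc _ = ‖v ^ 2 - ((2 * s : ℝ) : ℂ) ^ 2‖ * (s * (|v.im| * ‖F v‖)) := by ring
        _ ≤ 2 * (2 * s) ^ 2 * (s * C) := by gcongr
        _ ≤ _ := by nlinarith [mul_nonneg (pow_pos hs0 3).le hC0]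
    · rw [hcirc v _ h2]
      have := hup v (s / 2) (2 * s) hvc.2 (by positivity) (by linarith)
      calc _ = ‖v ^ 2 - ((s / 2 : ℝ) : ℂ) ^ 2‖ * (4 * s * (|v.im| * ‖F v‖)) := by ring
        _ ≤ 2 * (2 * s) ^ 2 * (4 * s * C) := by gcongr
        _ = _ := by ring
  have hmax := Complex.norm_le_of_forall_mem_frontier_norm_le hUb hdiff hfr
    (subset_closure (show w ∈ U from ⟨by linarith, by linarith⟩))
  simp only [hh, norm_smul, norm_mul] at hmax
  have hlow : ∀ r : ℝ, |s ^ 2 - r ^ 2| ≤ ‖w ^ 2 - (r : ℂ) ^ 2‖ := by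
    intro r
    have := abs_norm_sub_norm_le (w ^ 2) ((r : ℂ) ^ 2)
    rwa [norm_pow, norm_pow, Complex.norm_real, Real.norm_eq_abs, sq_abs] at this
  have h1 : 3 * s ^ 2 ≤ ‖w ^ 2 - ((2 * s : ℝ) : ℂ) ^ 2‖ :=
    le_trans (by rw [abs_sub_comm]; exact le_trans (by linarith) (le_abs_self _)) (hlow (2 * s))
  have h2 : 3 / 4 * s ^ 2 ≤ ‖w ^ 2 - ((s / 2 : ℝ) : ℂ) ^ 2‖ :=
    le_trans (le_trans (by linarith) (le_abs_self _)) (hlow (s / 2))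
  have h3 : 3 * s ^ 2 * (3 / 4 * s ^ 2) * ‖F w‖ ≤ 32 * s ^ 3 * C := le_trans (by gcongr) hmax
  have h4 : s ^ 3 * (9 / 4 * (s * ‖F w‖)) ≤ s ^ 3 * (32 * C) := by linarith
  have h5 := le_of_mul_le_mul_left h4 (pow_pos hs0 3)
  linarith

/-- Riemann's removable singularity theorem, used twice: `w • F w` is bounded near `0`, and if its
limit is zero then `F` is `o(1 / w)`. -/
theorem exists_tendsto_smul_of_abs_im_mul_norm_le {E : Type*} [NormedAddCommGroup E]
    [NormedSpace ℂ E] [CompleteSpace E] {F : ℂ → E} {δ C : ℝ} (hδ : 0 < δ)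
    (hd : ∀ w : ℂ, w ≠ 0 → ‖w‖ < δ → DifferentiableAt ℂ F w)
    (hC : ∀ w : ℂ, w ≠ 0 → ‖w‖ < δ → |w.im| * ‖F w‖ ≤ C) :
    ∃ P : E, Tendsto (fun w => w • F w) (𝓝[≠] 0) (𝓝 P) ∧
      (P = 0 → ∃ Q : E, Tendsto F (𝓝[≠] 0) (𝓝 Q)) := by
  have hnear : ∀ ε : ℝ, 0 < ε → ∀ᶠ w : ℂ in 𝓝[≠] 0, w ≠ 0 ∧ ‖w‖ < ε := fun ε hε => by
    filter_upwards [self_mem_nhdsWithin, mem_nhdsWithin_of_mem_nhds (Metric.ball_mem_nhds 0 hε)]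
      with w h1 h2
    exact ⟨h1, by simpa using h2⟩
  have hdF : ∀ᶠ w in 𝓝[≠] 0, DifferentiableAt ℂ F w := by
    filter_upwards [hnear δ hδ] with w hw using hd w hw.1 hw.2
  have hP : Tendsto (fun w => w • F w) (𝓝[≠] 0) (𝓝 (limUnder (𝓝[≠] 0) fun w => w • F w)) := by
    refine Complex.tendsto_limUnder_of_differentiable_on_punctured_nhds_of_bounded_under
      (f := fun w => w • F w) (c := 0) ?_ ⟨15 * C, ?_⟩
    · filter_upwards [hdF] with w hw using differentiableAt_id.smul hw
    · rw [eventually_map]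
      filter_upwards [hnear (δ / 2) (half_pos hδ)] with w hw
      rw [zero_smul, sub_zero, norm_smul]
      exact norm_mul_norm_le_of_abs_im_mul_norm_le hd hC hw.1 (by linarith [hw.2])
  refine ⟨_, hP, fun hP0 => ⟨_,
    Complex.tendsto_limUnder_of_differentiable_on_punctured_nhds_of_isLittleO hdF ?_⟩⟩
  · rw [hP0] at hP
    have ht' : Tendsto (fun w : ℂ => w • (F w - F 0)) (𝓝[≠] 0) (𝓝 0) := by
      have h0 : Tendsto (fun w : ℂ => w • F 0) (𝓝[≠] 0) (𝓝 0) := by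
        have : Tendsto (fun w : ℂ => w • F 0) (𝓝 0) (𝓝 ((0 : ℂ) • F 0)) :=
          Continuous.tendsto (by fun_prop) 0
        rw [zero_smul] at this
        exact this.mono_left nhdsWithin_le_nhds
      simpa [smul_sub] using hP.sub h0
    rw [Asymptotics.isLittleO_iff]
    intro c hc
    filter_upwards [hnear 1 one_pos, ht'.eventually (Metric.ball_mem_nhds 0 hc)] with w hw hw'
    have hw0 : 0 < ‖w‖ := norm_pos_iff.2 hw.1
    rw [dist_zero_right, norm_smul] at hw'
    rw [sub_zero, norm_inv, ← div_eq_mul_inv, le_div_iff₀ hw0, mul_comm]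
    exact hw'.le

theorem abs_le_two_mul_abs_one_sub_exp_neg {t : ℝ} (ht : |t| ≤ 1 / 2) :
    |t| ≤ 2 * |1 - Real.exp (-t)| := by
  have h := Real.abs_exp_sub_one_sub_id_le (x := -t) (by rw [abs_neg]; linarith)
  have h1 : |t| - |1 - Real.exp (-t)| ≤ |t - (1 - Real.exp (-t))| := abs_sub_abs_le_abs_sub _ _
  have h2 : t - (1 - Real.exp (-t)) = Real.exp (-t) - 1 - -t := by ring
  rw [h2] at h1
  have h3 : (-t) ^ 2 = |t| * |t| := by rw [abs_mul_abs_self]; ring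
  nlinarith [abs_nonneg t]

/-- An isolated unimodular point of the spectrum, around which the resolvent grows at most like the
inverse distance to the unit circle, is a simple pole of the resolvent. -/
theorem exists_ne_zero_mul_sub_eq_zero_of_isolated {A : Type*} [NormedRing A] [NormedAlgebra ℂ A]
    [CompleteSpace A] {a : A} {μ : ℂ} (hμ : ‖μ‖ = 1) (hmem : μ ∈ spectrum ℂ a) {ε : ℝ} (hε : 0 < ε)
    (hiso : ∀ z ∈ spectrum ℂ a, ‖z - μ‖ < ε → z = μ)
    (hres : ∀ z ∈ resolventSet ℂ a, |1 - ‖z‖| * ‖resolvent a z‖ ≤ 1) :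
    ∃ P : A, P ≠ 0 ∧ P * (algebraMap ℂ A μ - a) = 0 := by
  -- This chart sends the real line to the unit circle, turning distance to the circle into `|w.im|`
  -- up to a factor 2.
  set e : ℂ → ℂ := fun w => μ * Complex.exp (Complex.I * w) with he
  have hμ0 : μ ≠ 0 := norm_pos_iff.1 (by rw [hμ]; exact one_pos)
  have hec : Continuous e := by fun_prop
  have he0 : e 0 = μ := by simp [he]
  have hed : Differentiable ℂ e := by fun_prop
  have hnorm : ∀ w : ℂ, ‖e w‖ = Real.exp (-w.im) := fun w => by
    simp [he, Complex.norm_exp, hμ]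
  have hev : ∀ᶠ w in 𝓝 0, ‖e w - μ‖ < ε := by
    have : Tendsto (fun w => ‖e w - μ‖) (𝓝 0) (𝓝 ‖e 0 - μ‖) := Continuous.tendsto (by fun_prop) 0
    rw [he0, sub_self, norm_zero] at this
    exact this.eventually_lt_const hε
  obtain ⟨η, hη, hηε⟩ := Metric.eventually_nhds_iff_ball.1 hev
  have hrho : ∀ w : ℂ, w ≠ 0 → ‖w‖ < min η (1 / 2) → e w ∈ resolventSet ℂ a := by
    intro w hw0 hw
    by_contra hcon
    have h1 := hiso (e w) hcon (hηε w (by simpa using hw.trans_le (min_le_left _ _)))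
    have h2 : Complex.exp (Complex.I * w) = 1 := mul_left_cancel₀ hμ0 (by simpa [he] using h1)
    obtain ⟨n, hn⟩ := Complex.exp_eq_one_iff.1 h2
    have h3 : ‖w‖ = |(n : ℝ)| * (2 * Real.pi) := by
      have := congrArg norm hn
      simpa [abs_of_pos Real.pi_pos] using this
    have hw' : ‖w‖ < 1 / 2 := hw.trans_le (min_le_right _ _)
    rcases eq_or_ne n 0 with rfl | hn0
    · exact hw0 (norm_eq_zero.1 (by simpa using h3))
    · have h4 : (1 : ℝ) ≤ |(n : ℝ)| := by exact_mod_cast Int.one_le_abs hn0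
      nlinarith [Real.pi_gt_three]
  obtain ⟨P, hP, hQ⟩ := exists_tendsto_smul_of_abs_im_mul_norm_le (F := fun w => resolvent a (e w))
    (δ := min η (1 / 2)) (C := 2) (lt_min hη (by norm_num))
    (fun w hw0 hw => ((spectrum.hasDerivAt_resolvent_const_left
      (hrho w hw0 hw)).differentiableAt).comp w (hed w))
    (fun w hw0 hw => by
      have h1 := hres _ (hrho w hw0 hw)
      rw [hnorm] at h1
      have h2 := abs_le_two_mul_abs_one_sub_exp_neg (t := w.im)
        ((Complex.abs_im_le_norm w).trans (hw.trans_le (min_le_right _ _)).le)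
      calc |w.im| * ‖resolvent a (e w)‖
          ≤ 2 * |1 - Real.exp (-w.im)| * ‖resolvent a (e w)‖ := by gcongr
        _ ≤ 2 := by linarith)
  have hunit : ∀ᶠ w in 𝓝[≠] 0, IsUnit (algebraMap ℂ A (e w) - a) := by
    filter_upwards [self_mem_nhdsWithin, mem_nhdsWithin_of_mem_nhds (Metric.ball_mem_nhds (0 : ℂ)
      (lt_min hη (by norm_num : (0 : ℝ) < 1 / 2)))] with w h1 h2
    exact hrho w h1 (by simpa using h2)
  have hlim : Tendsto (fun w => algebraMap ℂ A (e w) - a) (𝓝[≠] 0) (𝓝 (algebraMap ℂ A μ - a)) := by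
    have : Tendsto (fun w => algebraMap ℂ A (e w) - a) (𝓝 0) (𝓝 (algebraMap ℂ A (e 0) - a)) :=
      Continuous.tendsto (((continuous_algebraMap ℂ A).comp hec).sub continuous_const) 0
    rw [he0] at this
    exact this.mono_left nhdsWithin_le_nhds
  refine ⟨P, fun hP0 => ?_, ?_⟩
  -- Without a pole, the limit `Q` of the resolvents would invert `μ - a`.
  · obtain ⟨Q, hQ⟩ := hQ hP0
    have h1 : Q * (algebraMap ℂ A μ - a) = 1 := by
      refine tendsto_nhds_unique (hQ.mul hlim) (tendsto_const_nhds.congr' ?_)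
      filter_upwards [hunit] with w hw using (Ring.inverse_mul_cancel _ hw).symm
    have h2 : (algebraMap ℂ A μ - a) * Q = 1 := by
      refine tendsto_nhds_unique (hlim.mul hQ) (tendsto_const_nhds.congr' ?_)
      filter_upwards [hunit] with w hw using (Ring.mul_inverse_cancel _ hw).symm
    exact hmem ⟨⟨_, Q, h2, h1⟩, rfl⟩
  · refine tendsto_nhds_unique (hP.mul hlim) ?_
    have h0 : Tendsto (fun w : ℂ => w • (1 : A)) (𝓝[≠] 0) (𝓝 0) := by
      have : Tendsto (fun w : ℂ => w • (1 : A)) (𝓝 0) (𝓝 ((0 : ℂ) • (1 : A))) :=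
        Continuous.tendsto (by fun_prop) 0
      rw [zero_smul] at this
      exact this.mono_left nhdsWithin_le_nhds
    refine h0.congr' ?_
    filter_upwards [hunit] with w hw
    rw [smul_mul_assoc]
    exact congrArg _ (Ring.inverse_mul_cancel _ hw).symm

/-- Otherwise the set is perfect and contains an injective image of the Cantor space. -/
theorem Set.Countable.exists_isolated {s : Set ℂ} (hs : s.Countable) (hc : IsClosed s)
    (hne : s.Nonempty) : ∃ μ ∈ s, ∃ ε > 0, ∀ z ∈ s, ‖z - μ‖ < ε → z = μ := by
  by_contra! hcon
  have hperf : Perfect s := ⟨hc, preperfect_iff_nhds.2 fun x hx U hU => by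
    obtain ⟨ε, hε, hεU⟩ := Metric.mem_nhds_iff.1 hU
    obtain ⟨z, hz, hzε, hne⟩ := hcon x hx ε hε
    exact ⟨z, ⟨hεU (by rwa [Metric.mem_ball, dist_eq_norm]), hz⟩, hne⟩⟩
  obtain ⟨f, hfs, -, hf⟩ := hperf.exists_nat_bool_injection hne
  have h1 : (Set.range f).Countable := hs.mono hfs
  have h2 : Countable (ℕ → Bool) := by
    have := h1.to_subtype
    exact (Set.rangeFactorization_injective.2 hf).countable
  rw [← Cardinal.mk_le_aleph0_iff] at h2
  exact (Cardinal.cantor Cardinal.aleph0).not_ge (by simpa using h2)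

universe u

/-! ### Spectrum of an isometry -/

section Isometry

variable {Z : Type*} [NormedAddCommGroup Z] [NormedSpace ℂ Z] {S : Z →L[ℂ] Z}

theorem abs_one_sub_norm_mul_norm_resolvent_le (hS : ∀ y, ‖S y‖ = ‖y‖) {z : ℂ}
    (hz : z ∈ resolventSet ℂ S) : |1 - ‖z‖| * ‖resolvent S z‖ ≤ 1 := by
  rcases eq_or_ne (1 - ‖z‖) 0 with h0 | h0
  · simp [h0]
  have hpos : 0 < |1 - ‖z‖| := abs_pos.2 h0
  have hbd : ‖resolvent S z‖ ≤ |1 - ‖z‖|⁻¹ := by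
    refine ContinuousLinearMap.opNorm_le_bound _ (by positivity) fun y => ?_
    have h1 : z • (resolvent S z y) - S (resolvent S z y) = y := by
      have := congrArg (fun B : Z →L[ℂ] Z => B y) (Ring.mul_inverse_cancel _ hz)
      simpa [Algebra.algebraMap_eq_smul_one, resolvent] using this
    have h2 : |1 - ‖z‖| * ‖resolvent S z y‖ ≤ ‖y‖ := by
      have h3 := abs_norm_sub_norm_le (z • (resolvent S z y)) (S (resolvent S z y))
      rw [h1, hS, norm_smul] at h3
      rwa [show ‖z‖ * ‖resolvent S z y‖ - ‖resolvent S z y‖ = -((1 - ‖z‖) * ‖resolvent S z y‖) by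
        ring, abs_neg, abs_mul, abs_of_nonneg (norm_nonneg (resolvent S z y))] at h3
    rw [inv_mul_eq_div, le_div_iff₀ hpos, mul_comm]
    exact h2
  calc _ ≤ |1 - ‖z‖| * |1 - ‖z‖|⁻¹ := by gcongr
    _ = 1 := mul_inv_cancel₀ hpos.ne'

/-- The spectrum of an isometry that does not contain the unit circle lies in the unit circle. -/
theorem spectrum_subset_sphere_of_isometry [CompleteSpace Z] [Nontrivial Z]
    (hS : ∀ y, ‖S y‖ = ‖y‖) {μ : ℂ} (hμ : ‖μ‖ = 1) (hμS : μ ∈ resolventSet ℂ S) :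
    spectrum ℂ S ⊆ Metric.sphere 0 1 := by
  have hball : Metric.ball (0 : ℂ) 1 ⊆ resolventSet ℂ S := by
    have hopen : IsOpen (resolventSet ℂ S) := spectrum.isOpen_resolventSet S
    refine (convex_ball (0 : ℂ) 1).isPreconnected.subset_of_closure_inter_subset hopen ?_ ?_
    · have h1 : μ ∈ closure (Metric.ball (0 : ℂ) 1) := by
        rw [closure_ball _ one_ne_zero]; simp [hμ]
      obtain ⟨z, h2, h3⟩ := mem_closure_iff.1 h1 _ hopen hμS
      exact ⟨z, h3, h2⟩
    · rintro z ⟨hz, hz1⟩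
      rw [mem_ball_zero_iff] at hz1
      -- This radius forces `‖z - v‖ < 1 - ‖v‖`, so the resolvent bound at `v` makes `z - S` a small
      -- enough perturbation of `v - S` to be invertible.
      obtain ⟨v, hv, hvz⟩ := Metric.mem_closure_iff.1 hz ((1 - ‖z‖) / 2) (by linarith)
      rw [dist_eq_norm] at hvz
      have hv1 : ‖v‖ ≤ ‖z‖ + ‖z - v‖ := by
        have := norm_sub_le z (z - v); rwa [sub_sub_cancel] at this
      obtain ⟨u, hu⟩ := hv
      have hRu : resolvent S v = (↑u⁻¹ : Z →L[ℂ] Z) := by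
        rw [resolvent, ← hu, Ring.inverse_unit]
      have h1 := abs_one_sub_norm_mul_norm_resolvent_le hS (z := v) ⟨u, hu⟩
      rw [hRu, abs_of_pos (by linarith)] at h1
      have hpos : 0 < ‖(↑u⁻¹ : Z →L[ℂ] Z)‖ := norm_pos_iff.2 u⁻¹.ne_zero
      refine (Units.ofNearby u (algebraMap ℂ (Z →L[ℂ] Z) z - S) ?_).isUnit
      rw [hu, sub_sub_sub_cancel_right, ← map_sub, norm_algebraMap']
      calc ‖z - v‖ < 1 - ‖v‖ := by linarith
        _ ≤ _ := by rw [← one_div, le_div_iff₀ hpos]; exact h1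
  intro z hz
  have hle : ‖z‖ ≤ 1 := (spectrum.norm_le_norm_of_mem hz).trans
    (ContinuousLinearMap.opNorm_le_bound _ zero_le_one fun y => by rw [hS, one_mul])
  rw [mem_sphere_zero_iff_norm]
  exact le_antisymm hle (not_lt.1 fun h => hz (hball (by simpa using h)))

end Isometry

/-! ### The orbit seminorm and the limit isometry -/

section Orbit

variable {X : Type*} [NormedAddCommGroup X] [NormedSpace ℂ X]

/-- A vector space, equipped with the topology of a given seminorm. -/
def SeminormSpace (_ : Seminorm ℂ X) : Type _ := X

namespace SeminormSpace

noncomputable instance (p : Seminorm ℂ X) : SeminormedAddCommGroup (SeminormSpace p) :=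
  p.toAddGroupSeminorm.toSeminormedAddCommGroup

noncomputable instance (p : Seminorm ℂ X) : Module ℂ (SeminormSpace p) :=
  inferInstanceAs (Module ℂ X)

noncomputable instance (p : Seminorm ℂ X) : NormedSpace ℂ (SeminormSpace p) where
  norm_smul_le c x := (map_smul_eq_mul p c x).le

/-- The identity map into the seminormed space. -/
def of (p : Seminorm ℂ X) : X →ₗ[ℂ] SeminormSpace p := LinearMap.id

end SeminormSpace

theorem IsPowerBounded.isBoundedUnder {T : X →L[ℂ] X} (hT : IsPowerBounded T) (x : X) :
    IsBoundedUnder (· ≤ ·) atTop fun n : ℕ => ‖(T ^ n) x‖ := by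
  obtain ⟨M, hM⟩ := hT
  exact isBoundedUnder_of ⟨M * ‖x‖, fun n => (T ^ n).le_of_opNorm_le (hM n) x⟩

theorem IsPowerBounded.limsup_le {T : X →L[ℂ] X} {x : X} {C : ℝ}
    (h : ∀ᶠ n in atTop, ‖(T ^ n) x‖ ≤ C) : limsup (fun n : ℕ => ‖(T ^ n) x‖) atTop ≤ C :=
  limsup_le_of_le (isCoboundedUnder_le_of_le atTop (x := 0) fun _ => norm_nonneg _) h

theorem IsPowerBounded.eventually_le {T : X →L[ℂ] X} (hT : IsPowerBounded T) (x : X) {ε : ℝ}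
    (hε : 0 < ε) :
    ∀ᶠ n in atTop, ‖(T ^ n) x‖ ≤ limsup (fun n : ℕ => ‖(T ^ n) x‖) atTop + ε :=
  (eventually_lt_of_limsup_lt (lt_add_of_pos_right _ hε) (hT.isBoundedUnder x)).mono
    fun _ h => h.le

/-- Lets scalars, `T` and its resolvents act boundedly for the orbit seminorm. -/
theorem IsPowerBounded.limsup_map_le {T U : X →L[ℂ] X} (hT : IsPowerBounded T) (hU : Commute T U)
    {C : ℝ} (hC : 0 ≤ C) (hUC : ∀ y, ‖U y‖ ≤ C * ‖y‖) (x : X) :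
    limsup (fun n : ℕ => ‖(T ^ n) (U x)‖) atTop ≤ C * limsup (fun n : ℕ => ‖(T ^ n) x‖) atTop := by
  have key : ∀ ε > 0, limsup (fun n : ℕ => ‖(T ^ n) (U x)‖) atTop ≤
      C * (limsup (fun n : ℕ => ‖(T ^ n) x‖) atTop + ε) := fun ε hε => by
    refine IsPowerBounded.limsup_le ?_
    filter_upwards [hT.eventually_le x hε] with n hn
    have h1 : (T ^ n) (U x) = U ((T ^ n) x) :=
      congrArg (fun B : X →L[ℂ] X => B x) (hU.pow_left n).eq
    rw [h1]
    exact (hUC _).trans (by gcongr)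
  refine le_of_forall_pos_le_add fun ε hε => (key (ε / (C + 1)) (by positivity)).trans ?_
  have : C * (ε / (C + 1)) ≤ ε := by
    rw [mul_div_assoc', div_le_iff₀ (by positivity)]; nlinarith
  linarith

/-- The seminorm `x ↦ limsup ‖T ^ n x‖`. -/
noncomputable def IsPowerBounded.orbitSeminorm {T : X →L[ℂ] X} (hT : IsPowerBounded T) :
    Seminorm ℂ X :=
  Seminorm.ofSMulLE (fun x => limsup (fun n : ℕ => ‖(T ^ n) x‖) atTop)
    (by simp)
    (fun x y => by
      refine le_of_forall_pos_le_add fun ε hε => IsPowerBounded.limsup_le ?_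
      filter_upwards [hT.eventually_le x (half_pos hε), hT.eventually_le y (half_pos hε)]
        with n hx hy
      rw [map_add]
      exact (norm_add_le _ _).trans (by linarith))
    (fun c x => hT.limsup_map_le (U := c • 1) ((Commute.one_right T).smul_right c)
      (norm_nonneg c) (fun y => by simp [norm_smul]) x)

/-- The completion of the space with respect to the orbit seminorm of `T`, and the isometry on it
that is induced by `T`. -/
theorem IsPowerBounded.exists_limit_isometry {X : Type u} [NormedAddCommGroup X] [NormedSpace ℂ X]
    {T : X →L[ℂ] X} (hT : IsPowerBounded T) :
    ∃ (Z : Type u) (_ : NormedAddCommGroup Z) (_ : NormedSpace ℂ Z) (_ : CompleteSpace Z)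
      (ι : X →L[ℂ] Z) (S : Z →L[ℂ] Z), DenseRange ι ∧ (∀ y, ‖S y‖ = ‖y‖) ∧
      (∀ x, S (ι x) = ι (T x)) ∧ (∀ x, ι x = 0 → Tendsto (fun n : ℕ => ‖(T ^ n) x‖) atTop (𝓝 0)) ∧
      resolventSet ℂ T ⊆ resolventSet ℂ S := by
  set p := hT.orbitSeminorm with hp
  have hpx : ∀ x, p x = limsup (fun n : ℕ => ‖(T ^ n) x‖) atTop := fun _ => rfl
  let lift (U : X →L[ℂ] X) (hU : Commute T U) : SeminormSpace p →L[ℂ] SeminormSpace p :=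
    LinearMap.mkContinuous (U : X →ₗ[ℂ] X) ‖U‖
      (hT.limsup_map_le hU (norm_nonneg U) fun y => U.le_opNorm y)
  let i : X →ₗ[ℂ] UniformSpace.Completion (SeminormSpace p) :=
    (UniformSpace.Completion.toComplₗᵢ (𝕜 := ℂ) (E := SeminormSpace p)).toLinearMap.comp
      (SeminormSpace.of p)
  have hi : ∀ x, ‖i x‖ = p x := fun x => UniformSpace.Completion.norm_coe _
  have hid : DenseRange i := UniformSpace.Completion.denseRange_coe (α := SeminormSpace p)
  have hlift : ∀ U hU x, (lift U hU).completion (i x) = i (U x) := fun U hU x =>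
    ContinuousLinearMap.completion_apply_coe (lift U hU) x
  obtain ⟨M, hM⟩ := id hT
  let ι : X →L[ℂ] UniformSpace.Completion (SeminormSpace p) := i.mkContinuous M fun x => by
    rw [hi, hpx]
    exact IsPowerBounded.limsup_le (Eventually.of_forall fun n => (T ^ n).le_of_opNorm_le (hM n) x)
  refine ⟨UniformSpace.Completion (SeminormSpace p), inferInstance, inferInstance, inferInstance,
    ι, (lift T (Commute.refl T)).completion, hid, ?_, hlift T (Commute.refl T), ?_, ?_⟩
  · intro y
    refine hid.induction_on y (isClosed_eq (by fun_prop) continuous_norm) fun x => ?_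
    rw [hlift T (Commute.refl T), hi, hi, hpx, hpx, ← limsup_nat_add (fun n => ‖(T ^ n) x‖) 1]
    simp only [pow_succ, mul_apply_eq_comp]
  · intro x hx
    have h0 : limsup (fun n : ℕ => ‖(T ^ n) x‖) atTop = 0 := by
      rw [← hpx, ← hi]; exact norm_eq_zero.2 hx
    rw [Metric.tendsto_atTop]
    intro ε hε
    obtain ⟨N, hN⟩ := eventually_atTop.1 (hT.eventually_le x (half_pos hε))
    refine ⟨N, fun n hn => ?_⟩
    rw [Real.dist_eq, sub_zero, abs_of_nonneg (norm_nonneg _)]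
    linarith [hN n hn]
  · intro z hz
    have hcomm : Commute T (resolvent T z) := by
      obtain ⟨u, hu⟩ := hz
      have h : Commute T (u : X →L[ℂ] X) := by
        rw [hu]
        exact Commute.sub_right (Algebra.commutes z T).symm (Commute.refl T)
      rw [resolvent, ← hu, Ring.inverse_unit]
      exact h.units_inv_right
    have h1 := fun x => congrArg (fun B : X →L[ℂ] X => i (B x)) (Ring.inverse_mul_cancel _ hz)
    have h2 := fun x => congrArg (fun B : X →L[ℂ] X => i (B x)) (Ring.mul_inverse_cancel _ hz)
    refine ⟨⟨_, (lift _ hcomm).completion, ?_, ?_⟩, rfl⟩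
    · ext y
      refine hid.induction_on y (isClosed_eq (ContinuousLinearMap.continuous _)
        (ContinuousLinearMap.continuous _)) fun x => ?_
      have := h2 x
      simp [Algebra.algebraMap_eq_smul_one, hlift] at this ⊢
      exact this
    · ext y
      refine hid.induction_on y (isClosed_eq (ContinuousLinearMap.continuous _)
        (ContinuousLinearMap.continuous _)) fun x => ?_
      have := h1 x
      simp [Algebra.algebraMap_eq_smul_one, hlift] at this ⊢
      exact this

end Orbit

/-! ### Peripheral spectrum of restrictions -/

section Spectrum

variable {X : Type*} [NormedAddCommGroup X] [NormedSpace ℂ X]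

theorem IsPowerBounded.norm_le_one_of_mem_spectrum [CompleteSpace X] {T : X →L[ℂ] X}
    (hT : IsPowerBounded T) {z : ℂ} (hz : z ∈ spectrum ℂ T) : ‖z‖ ≤ 1 := by
  obtain ⟨M, hM⟩ := hT
  by_contra! h
  obtain ⟨n, hn⟩ := pow_unbounded_of_one_lt (M * ‖(1 : X →L[ℂ] X)‖) h
  have h1 := spectrum.norm_le_norm_mul_of_mem (spectrum.pow_mem_pow T n hz)
  rw [norm_pow] at h1
  have := h1.trans (mul_le_mul_of_nonneg_right (hM n) (norm_nonneg _))
  linarith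

/-- The restriction of a bounded operator to an invariant subspace. -/
def ContinuousLinearMap.restrictInvariant (T : X →L[ℂ] X) (Y : Submodule ℂ X)
    (hY : ∀ y ∈ Y, T y ∈ Y) : Y →L[ℂ] Y :=
  (T.comp Y.subtypeL).codRestrict Y fun y => hY y y.2

theorem ContinuousLinearMap.coe_restrictInvariant_apply (T : X →L[ℂ] X) (Y : Submodule ℂ X)
    (hY : ∀ y ∈ Y, T y ∈ Y) (y : Y) : (T.restrictInvariant Y hY y : X) = T y := rfl

theorem ContinuousLinearMap.coe_restrictInvariant_pow_apply (T : X →L[ℂ] X) (Y : Submodule ℂ X)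
    (hY : ∀ y ∈ Y, T y ∈ Y) (n : ℕ) (y : Y) :
    ((T.restrictInvariant Y hY ^ n) y : X) = (T ^ n) y := by
  induction n generalizing y with
  | zero => rfl
  | succ n ih =>
    rw [pow_succ, pow_succ, mul_apply_eq_comp, ih, mul_apply_eq_comp,
      T.coe_restrictInvariant_apply]

theorem IsPowerBounded.restrictInvariant {T : X →L[ℂ] X} (hT : IsPowerBounded T)
    (Y : Submodule ℂ X) (hY : ∀ y ∈ Y, T y ∈ Y) : IsPowerBounded (T.restrictInvariant Y hY) := by
  obtain ⟨M, hM⟩ := hT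
  refine ⟨M, fun n => ContinuousLinearMap.opNorm_le_bound _ ((norm_nonneg _).trans (hM 0))
    fun y => ?_⟩
  rw [Submodule.coe_norm, T.coe_restrictInvariant_pow_apply]
  exact (T ^ n).le_of_opNorm_le (hM n) y

theorem mem_resolventSet_restrictInvariant {T : X →L[ℂ] X} {Y : Submodule ℂ X}
    {hY : ∀ y ∈ Y, T y ∈ Y} {z : ℂ} (hz : z ∈ resolventSet ℂ T)
    (hR : ∀ y ∈ Y, resolvent T z y ∈ Y) : z ∈ resolventSet ℂ (T.restrictInvariant Y hY) := by
  have h1 := fun x => congrArg (fun B : X →L[ℂ] X => B x) (Ring.inverse_mul_cancel _ hz)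
  have h2 := fun x => congrArg (fun B : X →L[ℂ] X => B x) (Ring.mul_inverse_cancel _ hz)
  exact ⟨⟨algebraMap ℂ (Y →L[ℂ] Y) z - T.restrictInvariant Y hY,
    (resolvent T z).restrictInvariant Y hR,
    ContinuousLinearMap.ext fun y => Subtype.ext (h2 y),
    ContinuousLinearMap.ext fun y => Subtype.ext (h1 y)⟩, rfl⟩

theorem resolvent_apply_mem_of_mem_resolventSet_restrictInvariant {T : X →L[ℂ] X}
    {Y : Submodule ℂ X} {hY : ∀ y ∈ Y, T y ∈ Y} {z : ℂ} (hz : z ∈ resolventSet ℂ T)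
    (hzY : z ∈ resolventSet ℂ (T.restrictInvariant Y hY)) {y : X} (hy : y ∈ Y) :
    resolvent T z y ∈ Y := by
  set v := resolvent (T.restrictInvariant Y hY) z ⟨y, hy⟩
  have h1 : (algebraMap ℂ (X →L[ℂ] X) z - T) v = y :=
    congrArg (fun B : Y →L[ℂ] Y => (B ⟨y, hy⟩ : X)) (Ring.mul_inverse_cancel _ hzY)
  have h2 : resolvent T z ((algebraMap ℂ (X →L[ℂ] X) z - T) v) = v :=
    congrArg (fun B : X →L[ℂ] X => B v) (Ring.inverse_mul_cancel _ hz)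
  rw [h1] at h2
  rw [h2]
  exact v.2

/-- Restricting a power-bounded operator to a closed invariant subspace does not enlarge the
peripheral spectrum. -/
theorem IsPowerBounded.mem_resolventSet_restrictInvariant [CompleteSpace X] {T : X →L[ℂ] X}
    (hT : IsPowerBounded T) {Y : Submodule ℂ X} (hYc : IsClosed (Y : Set X))
    (hY : ∀ y ∈ Y, T y ∈ Y) {μ : ℂ} (hμ : ‖μ‖ = 1) (hμT : μ ∈ resolventSet ℂ T) :
    μ ∈ resolventSet ℂ (T.restrictInvariant Y hY) := by
  have : CompleteSpace Y := hYc.completeSpace_coe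
  refine _root_.mem_resolventSet_restrictInvariant hμT fun y hy => ?_
  -- Approach `μ` radially from outside the disc, where both resolvents exist; `Y` is closed.
  have hlim : Tendsto (fun t : ℝ => (t : ℂ) * μ) (𝓝[>] 1) (𝓝 μ) := by
    have : Tendsto (fun t : ℝ => (t : ℂ) * μ) (𝓝 1) (𝓝 (((1 : ℝ) : ℂ) * μ)) :=
      Continuous.tendsto (by fun_prop) 1
    rw [Complex.ofReal_one, one_mul] at this
    exact this.mono_left nhdsWithin_le_nhds
  have hcont : ContinuousAt (fun z => resolvent T z y) μ :=
    ((spectrum.hasDerivAt_resolvent_const_left hμT).continuousAt).clm_apply continuousAt_const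
  refine hYc.mem_of_tendsto (hcont.tendsto.comp hlim) ?_
  filter_upwards [self_mem_nhdsWithin] with t ht
  have hnt : ¬ ‖(t : ℂ) * μ‖ ≤ 1 := by
    rw [norm_mul, hμ, mul_one, Complex.norm_real, Real.norm_eq_abs, not_le]
    exact (Set.mem_Ioi.1 ht).trans_le (le_abs_self t)
  exact resolvent_apply_mem_of_mem_resolventSet_restrictInvariant
    (not_not.1 fun h => hnt (hT.norm_le_one_of_mem_spectrum h))
    (not_not.1 fun h => hnt ((hT.restrictInvariant Y hY).norm_le_one_of_mem_spectrum h)) hy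

end Spectrum

/-! ### Stability theorem and the equivalences -/

theorem not_countable_unitSphere : ¬ (Metric.sphere (0 : ℂ) 1).Countable := by
  intro h
  have hinj : Set.InjOn (fun t : ℝ => Complex.exp (t * Complex.I)) (Set.Icc 0 1) := by
    intro s hs t ht hst
    have h1 := congrArg Complex.re hst
    simp only [Complex.exp_ofReal_mul_I_re] at h1
    exact Real.injOn_cos ⟨hs.1, hs.2.trans (by linarith [Real.pi_gt_three])⟩
      ⟨ht.1, ht.2.trans (by linarith [Real.pi_gt_three])⟩ h1
  have hc : (Set.Icc (0 : ℝ) 1).Countable :=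
    Set.MapsTo.countable_of_injOn (fun t _ => by simp [Complex.norm_exp_ofReal_mul_I]) hinj h
  rw [← Cardinal.le_aleph0_iff_set_countable, Cardinal.mk_Icc_real zero_lt_one] at hc
  exact Cardinal.aleph0_lt_continuum.not_ge hc

/-- The stability theorem of Arendt, Batty, Lyubich and Vũ. -/
theorem IsPowerBounded.tendsto_norm_pow_apply_zero {X : Type*} [NormedAddCommGroup X]
    [NormedSpace ℂ X] {T : X →L[ℂ] X} (hT : IsPowerBounded T)
    (hσ : (spectrum ℂ T ∩ Metric.sphere (0 : ℂ) 1).Countable)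
    (heig : ∀ (φ : StrongDual ℂ X) (μ : ℂ), ‖μ‖ = 1 → (∀ x, φ (T x) = μ * φ x) → φ = 0) (x : X) :
    Tendsto (fun n : ℕ => ‖(T ^ n) x‖) atTop (𝓝 0) := by
  obtain ⟨Z, _, _, _, ι, S, hι, hS, hSι, hker, hρ⟩ := hT.exists_limit_isometry
  cases subsingleton_or_nontrivial Z with
  | inl _ => exact hker x (Subsingleton.elim _ _)
  | inr _ =>
    exfalso
    obtain ⟨ν, hν, hνS⟩ : ∃ ν : ℂ, ‖ν‖ = 1 ∧ ν ∈ resolventSet ℂ S := by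
      by_contra! hcon
      refine not_countable_unitSphere (Set.Countable.mono (fun z hz => ?_) hσ)
      refine ⟨fun h => ?_, hz⟩
      exact hcon z (by simpa using hz) (hρ h)
    have hsub := spectrum_subset_sphere_of_isometry hS hν hνS
    have hcount : (spectrum ℂ S).Countable := by
      refine Set.Countable.mono (fun z hz => ?_) hσ
      exact ⟨fun h => hz (hρ h), hsub hz⟩
    obtain ⟨μ, hμ, ε, hε, hiso⟩ :=
      hcount.exists_isolated (spectrum.isClosed S) (spectrum.nonempty S)
    have hμ1 : ‖μ‖ = 1 := by simpa using hsub hμ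
    obtain ⟨P, hP0, hP⟩ := exists_ne_zero_mul_sub_eq_zero_of_isolated hμ1 hμ hε hiso
      fun z hz => abs_one_sub_norm_mul_norm_resolvent_le hS hz
    have hPS : ∀ y, P (S y) = μ • P y := fun y => by
      have h : P ((algebraMap ℂ (Z →L[ℂ] Z) μ - S) y) = 0 :=
        congrArg (fun B : Z →L[ℂ] Z => B y) hP
      rw [Algebra.algebraMap_eq_smul_one, sub_apply, map_sub] at h
      simpa using (sub_eq_zero.1 h).symm
    obtain ⟨y, hy⟩ : ∃ y, P y ≠ 0 := by
      by_contra! hcon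
      exact hP0 (ContinuousLinearMap.ext hcon)
    -- `g ∘ P ∘ ι` is an eigenfunctional of `T`; it vanishes by hypothesis, so density of `ι` gives
    -- `g ∘ P = 0`.
    obtain ⟨g, -, hg⟩ := exists_dual_vector ℂ (P y) (norm_ne_zero_iff.2 hy)
    have hzero := heig ((g.comp P).comp ι) μ hμ1 fun x => by simp [← hSι, hPS]
    have hgP : ∀ z, g (P z) = 0 := fun z =>
      hι.induction_on z (isClosed_eq (by fun_prop) continuous_const) fun x =>
        congrArg (fun f : StrongDual ℂ X => f x) hzero
    rw [hgP] at hg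
    exact hy (norm_eq_zero.1 (Complex.ofReal_eq_zero.1 hg.symm))

/-- The orbit of `x` tends to zero if no functional has constant nonzero modulus along it. -/
theorem IsPowerBounded.tendsto_norm_pow_apply_zero_of_forall_dual {X : Type*}
    [NormedAddCommGroup X] [NormedSpace ℂ X] [CompleteSpace X] {T : X →L[ℂ] X}
    (hT : IsPowerBounded T) (hσ : (spectrum ℂ T ∩ Metric.sphere (0 : ℂ) 1).Countable) {x : X}
    (hx : ∀ φ : StrongDual ℂ X, (∀ k : ℕ, ‖φ ((T ^ k) x)‖ = ‖φ x‖) → φ x = 0) :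
    Tendsto (fun n : ℕ => ‖(T ^ n) x‖) atTop (𝓝 0) := by
  set Y := (Submodule.span ℂ (Set.range fun n : ℕ => (T ^ n) x)).topologicalClosure with hYdef
  have hYc : IsClosed (Y : Set X) := Submodule.isClosed_topologicalClosure _
  have horb : ∀ n : ℕ, (T ^ n) x ∈ Y := fun n =>
    Submodule.le_topologicalClosure _ (Submodule.subset_span ⟨n, rfl⟩)
  have hmin : ∀ V : Submodule ℂ X, IsClosed (V : Set X) → (∀ n : ℕ, (T ^ n) x ∈ V) → Y ≤ V :=
    fun V hV h => Submodule.topologicalClosure_minimal _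
      (Submodule.span_le.2 (by rintro _ ⟨n, rfl⟩; exact h n)) hV
  have hY : ∀ y ∈ Y, T y ∈ Y := fun y hy =>
    hmin (Y.comap (T : X →ₗ[ℂ] X)) (hYc.preimage T.continuous)
      (fun n => by
        have := horb (n + 1)
        rwa [pow_succ', mul_apply_eq_comp] at this) hy
  set TY := T.restrictInvariant Y hY with hTY
  set x₀ : Y := ⟨x, horb 0⟩ with hx₀
  have hpow : ∀ n : ℕ, ((TY ^ n) x₀ : X) = (T ^ n) x := fun n =>
    T.coe_restrictInvariant_pow_apply Y hY n x₀
  have hσY : (spectrum ℂ TY ∩ Metric.sphere (0 : ℂ) 1).Countable := by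
    refine Set.Countable.mono (fun z hz => ?_) hσ
    exact ⟨fun h => hz.1 (hT.mem_resolventSet_restrictInvariant hYc hY (by simpa using hz.2) h),
      hz.2⟩
  have key := (hT.restrictInvariant Y hY).tendsto_norm_pow_apply_zero hσY ?_ x₀
  · simpa only [Submodule.coe_norm, ← hTY, hpow] using key
  · intro φ μ hμ hφ
    obtain ⟨g, hg, -⟩ := exists_extension_norm_eq Y φ
    have hφn : ∀ n : ℕ, φ ((TY ^ n) x₀) = μ ^ n * φ x₀ := fun n => by
      induction n with
      | zero => simp
      | succ n ih => rw [pow_succ', mul_apply_eq_comp, hφ, ih]; ring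
    have hgn : ∀ n : ℕ, g ((T ^ n) x) = μ ^ n * φ x₀ := fun n => by
      rw [← hpow, hg, hφn]
    have hgx : g x = φ x₀ := hg x₀
    have h0 : g x = 0 := hx g fun k => by rw [hgn, hgx, norm_mul, norm_pow, hμ, one_pow, one_mul]
    have hle : Y ≤ LinearMap.ker (g : X →ₗ[ℂ] ℂ) :=
      hmin _ (isClosed_singleton.preimage g.continuous) fun n => by
        change g ((T ^ n) x) = 0
        rw [hgn, ← hgx, h0, mul_zero]
    refine ContinuousLinearMap.ext fun y => ?_
    rw [← hg]
    exact hle y.2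

theorem mainTheorem5 {X : Type*} [NormedAddCommGroup X] [NormedSpace ℂ X] [CompleteSpace X]
    (T : X →L[ℂ] X) (hT : IsPowerBounded T)
    (hσ : (spectrum ℂ T ∩ Metric.sphere (0 : ℂ) 1).Countable) (x : X) :
    List.TFAE [
      ∃ n : ℕ → ℕ, StrictMono n ∧
        Tendsto (fun j => toWeakSpace ℂ X ((T ^ n j) x)) atTop (𝓝 (0 : WeakSpace ℂ X)),
      ∀ φ : StrongDual ℂ X,
        Tendsto (fun n : ℕ => (1 / (n : ℝ)) * ∑ k ∈ Finset.Icc 1 n, ‖φ ((T ^ k) x)‖)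
          atTop (𝓝 0),
      Tendsto (fun n : ℕ => ‖(T ^ n) x‖) atTop (𝓝 0)] := by
  tfae_have 1 → 3 := by
    rintro ⟨n, -, hn⟩
    refine hT.tendsto_norm_pow_apply_zero_of_forall_dual hσ fun φ hφ => ?_
    have h1 : Tendsto (fun j => φ ((T ^ n j) x)) atTop (𝓝 (φ 0)) :=
      ((WeakBilin.eval_continuous (topDualPairing ℂ X).flip φ).tendsto 0).comp hn
    have h2 := h1.norm
    simp only [hφ, map_zero, norm_zero] at h2
    exact norm_eq_zero.1 (tendsto_nhds_unique tendsto_const_nhds h2)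
  tfae_have 2 → 3 := by
    intro h
    refine hT.tendsto_norm_pow_apply_zero_of_forall_dual hσ fun φ hφ => ?_
    refine norm_eq_zero.1 (tendsto_nhds_unique (tendsto_const_nhds.congr' ?_) (h φ))
    filter_upwards [eventually_gt_atTop 0] with n hn
    have : (n : ℝ) ≠ 0 := by positivity
    simp only [hφ, Finset.sum_const, Nat.card_Icc, add_tsub_cancel_right, nsmul_eq_mul]
    field_simp
  tfae_have 3 → 1 := by
    intro h
    refine ⟨id, strictMono_id, ?_⟩
    have h1 : Tendsto (fun n : ℕ => (T ^ n) x) atTop (𝓝 0) := tendsto_zero_iff_norm_tendsto_zero.2 h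
    have h2 := ((toWeakSpaceCLM ℂ X).continuous.tendsto 0).comp h1
    rwa [map_zero] at h2
  tfae_have 3 → 2 := by
    intro h φ
    have h1 : Tendsto (fun n : ℕ => ‖φ ((T ^ (n + 1)) x)‖) atTop (𝓝 0) := by
      have h2 : Tendsto (fun n : ℕ => (T ^ n) x) atTop (𝓝 0) :=
        tendsto_zero_iff_norm_tendsto_zero.2 h
      have h3 := ((φ.continuous.norm.tendsto 0).comp h2).comp (tendsto_add_atTop_nat 1)
      rwa [map_zero, norm_zero] at h3
    refine h1.cesaro.congr fun n => ?_
    rw [one_div, Finset.range_eq_Ico, Finset.sum_Ico_add' (fun k => ‖φ ((T ^ k) x)‖) 0 n 1]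
    rfl
  tfae_finish
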